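/- Fix $n,m,K,N\in\mathbb N$ with $N\ge 1$, real numbers $E\ge 0$ and $\varepsilon\ge 0$, and write $[m]=\{1,\dots,m\}$. Let $C_\Theta:\mathbb R^n\to\mathbb R^m$, $\Theta\in\mathbb R^K$, be the feed-forward networks of a fixed structure: a composition of finitely many layers $x\mapsto\sigma(Wx+b)$ where $\sigma$ applies to each coordinate a Lipschitz activation function (possibly depending on the coordinate and the layer; for instance ReLU in the hidden layers and ReLU or the identity in the output layer) and each entry of the matrices $W$ and vectors $b$ is either a fixed constant or one of the $K$ coordinates of $\Theta$ (for a fully connected network, the entries are distinct coordinates). Let $L:\mathbb R^m\times[m]\to\mathbb R$ be a loss function such that $L(\cdot,y)$ is continuous for every $y$, and let $T=((x_i,y_i))_{i=1}^N$ be samples in $[0,1]^n\times[m]$. Put $$S_c=[-E,E]^K,\qquad S_a=\prod_{i=1}^N\{(\overline x_i,y_i):\ \overline x_i\in\mathbb R^n,\ \|\overline x_i-x_i\|_\infty\le\varepsilon\},\qquad \mathcal H=\{C_\Theta:\Theta\in S_c\},$$ $$\varphi_T(\Theta,A)=\frac1N\sum_{i=1}^N L(C_\Theta(\overline x_i),y_i)\qquad\text{for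 }\Theta\in S_c,\ A=((\overline x_i,y_i))_{i=1}^N\in S_a.$$ The Classifier chooses $\Theta$ to minimize $\varphi_T$, and the Adversary chooses $A$ to maximize it. (1) Let $\mathcal G_2$ be the sequential game with the Adversary as the leader and the Classifier as the follower. A pair $(\Theta_2^*,A_2^*)\in S_c\times S_a$ is a Stackelberg equilibrium of $\mathcal G_2$ if $\gamma(A)=\operatorname{argmin}_{\Theta\in S_c}\varphi_T(\Theta,A)$ is non-empty for every $A\in S_a$, $\Theta_2^*\in\gamma(A_2^*)$, and $\varphi_T(\Theta_2^*,A_2^*)\ge\varphi_T(\Theta,A)$ whenever $A\in S_a$ and $\Theta\in\gamma(A)$. Then $\mathcal G_2$ has a Stackelberg equilibrium. For every Stackelberg equilibrium $(\Theta_2^*,A_2^*)$, the samples $A_2^*$ are an optimal universal (no-box) attack for $\mathcal H$, that is, $$A_2^*\in\operatorname{argmax}_{A\in S_a}\ \min_{f\in\mathcal H}\ \frac1N\sum_{i=1}^N L(f(\overline x_i),y_i),$$ where all the minima are attained, and $\varphi_T(\Theta_2^*,A_2^*)$ is the value of this maximum. (2) Let $\mathcal G_3$ be the simultaneous game with the same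 players, strategy spaces and payoff, let $\widetilde S_c$ and $\widetilde S_a$ be the sets of Borel probability measures on $S_c$ and on $S_a$ (mixed strategies), and let $\varphi_T(\widetilde\Theta,\widetilde A)=\mathbb E_{\Theta\sim\widetilde\Theta}\mathbb E_{A\sim\widetilde A}\,\varphi_T(\Theta,A)$; $\varphi_T$ is integrable with respect to every product $\widetilde\Theta\otimes\widetilde A$. Then $\mathcal G_3$ has a mixed strategy Nash equilibrium: there is $(\widetilde\Theta_3^*,\widetilde A_3^*)\in\widetilde S_c\times\widetilde S_a$ with $$\varphi_T(\widetilde\Theta_3^*,\widetilde A)\le\varphi_T(\widetilde\Theta_3^*,\widetilde A_3^*)\le\varphi_T(\widetilde\Theta,\widetilde A_3^*)\qquad\text{for all }\widetilde\Theta\in\widetilde S_c,\ \widetilde A\in\widetilde S_a.$$ At every such equilibrium the minimax theorem holds: $$\min_{\widetilde\Theta\in\widetilde S_c}\max_{\widetilde A\in\widetilde S_a}\varphi_T(\widetilde\Theta,\widetilde A)=\varphi_T(\widetilde\Theta_3^*,\widetilde A_3^*)=\max_{\widetilde A\in\widetilde S_a}\min_{\widetilde\Theta\in\widetilde S_c}\varphi_T(\widetilde\Theta,\widetilde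 A),$$ where all the maxima and minima are attained. -/

import Mathlib

open Set MeasureTheory

noncomputable section

namespace AdvGame

/-! ### Networks -/

/-- The structure (architecture) of a feed-forward network with inputs in `ℝ^n`, outputs in `ℝ^m`
and `K` real parameters.  A layer computes `x ↦ σ (W x + b)`; an entry of `W` or `b` is either one
of the parameters (`Sum.inl k`) or a fixed constant (`Sum.inr c`), and each neuron has a Lipschitz
activation function.  If all entries of all `W` and `b` are distinct parameters and all activations
are ReLU (or the identity in the output layer), this is the fully connected ReLU network of
prescribed depth and widths; repeated parameters and constant entries give convolutional,
recurrent (unrolled) and other fixed structures. -/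
inductive Architecture (K n : ℕ) : ℕ → Type
  | input : Architecture K n n
  | layer {p q : ℕ} (prev : Architecture K n p)
      (W : Matrix (Fin q) (Fin p) (Fin K ⊕ ℝ)) (b : Fin q → Fin K ⊕ ℝ)
      (σ : Fin q → ℝ → ℝ) (hσ : ∀ j, ∃ c, LipschitzWith c (σ j)) : Architecture K n q

/-- The value of an entry (parameter label or constant) for the parameter vector `Θ`. -/
def entry {K : ℕ} (Θ : Fin K → ℝ) : Fin K ⊕ ℝ → ℝ := Sum.elim Θ id

/-- The network `C_Θ : ℝ^n → ℝ^m` of a given structure with parameter vector `Θ ∈ ℝ^K`. -/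
def Architecture.net {K n : ℕ} : {m : ℕ} → Architecture K n m → (Fin K → ℝ) →
    (Fin n → ℝ) → (Fin m → ℝ)
  | _, .input, _, x => x
  | _, .layer prev W b σ _, Θ, x => fun j =>
      σ j ((∑ i, entry Θ (W j i) * prev.net Θ x i) + entry Θ (b j))

/-! ### Strategy spaces and payoff -/

/-- The strategy space `S_c = [-E, E]^K` of the Classifier. -/
def ClassifierSpace (K : ℕ) (E : ℝ) : Set (Fin K → ℝ) := {Θ | ∀ k, Θ k ∈ Icc (-E) E}

/-- The hypothesis class: all networks of the given structure with parameters in `[-E, E]^K`. -/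
def hypothesisClass {K n m : ℕ} (𝒩 : Architecture K n m) (E : ℝ) :
    Set ((Fin n → ℝ) → (Fin m → ℝ)) := 𝒩.net '' ClassifierSpace K E

/-- The strategy space `S_a = ∏ᵢ {(x̄ᵢ, yᵢ) : ‖x̄ᵢ - xᵢ‖_∞ ≤ ε}` of the Adversary
(the norm of `Fin n → ℝ` is the sup norm). -/
def AdversarySpace {N n m : ℕ} (T : Fin N → (Fin n → ℝ) × Fin m) (ε : ℝ) :
    Set (Fin N → (Fin n → ℝ) × Fin m) :=
  {A | ∀ i, ‖(A i).1 - (T i).1‖ ≤ ε ∧ (A i).2 = (T i).2}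

/-- The empirical loss `(1/N) ∑ᵢ L(f(x̄ᵢ), yᵢ)` of a classifier `f` on `A = ((x̄ᵢ, yᵢ))ᵢ`. -/
def empiricalLoss {N n m : ℕ} (L : (Fin m → ℝ) → Fin m → ℝ) (f : (Fin n → ℝ) → (Fin m → ℝ))
    (A : Fin N → (Fin n → ℝ) × Fin m) : ℝ :=
  (1 / (N : ℝ)) * ∑ i, L (f (A i).1) (A i).2

/-- The payoff `φ_T(Θ, A)`: the empirical adversarial loss.  The Classifier minimizes it and the
Adversary maximizes it. -/
def payoff {K N n m : ℕ} (𝒩 : Architecture K n m) (L : (Fin m → ℝ) → Fin m → ℝ)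
    (T : Fin N → (Fin n → ℝ) × Fin m) (E ε : ℝ)
    (Θ : ClassifierSpace K E) (A : AdversarySpace T ε) : ℝ :=
  empiricalLoss L (𝒩.net Θ.1) A.1

/-! ### Stackelberg games -/

section Games

variable {α β : Type*}

/-- `γ(a)`: the set of best responses of the (maximizing) follower to the leader's strategy `a`. -/
def bestResponses (φ : α → β → ℝ) (a : α) : Set β := {b | ∀ b', φ a b' ≤ φ a b}

/-- `Γ`: the pairs of a leader's strategy and a best response to it. -/
def responseGraph (φ : α → β → ℝ) : Set (α × β) := {p | p.2 ∈ bestResponses φ p.1}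

/-- Stackelberg equilibria of the zero-sum minmax sequential game in which the leader chooses
`a : α` to minimize `φ` and the follower then chooses `b : β` to maximize `φ`. -/
def IsStackelbergEquilibrium (φ : α → β → ℝ) (a : α) (b : β) : Prop :=
  (∀ a', (bestResponses φ a').Nonempty) ∧ (a, b) ∈ responseGraph φ ∧
    ∀ p ∈ responseGraph φ, φ a b ≤ φ p.1 p.2

/-- Stackelberg equilibria `(Θ, A)` of the zero-sum maxmin sequential game in which the
maximizer of `φ` is the leader and the minimizer is the follower. -/
def IsMaxminStackelbergEquilibrium (φ : α → β → ℝ) (a : α) (b : β) : Prop :=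
  IsStackelbergEquilibrium (fun b' a' => -φ a' b') b a

/-! ### Mixed strategies in the simultaneous game -/

/-- The expected payoff of a pair of mixed strategies. -/
def mixedPayoff [MeasurableSpace α] [MeasurableSpace β] (φ : α → β → ℝ)
    (μ : ProbabilityMeasure α) (ν : ProbabilityMeasure β) : ℝ :=
  ∫ a, ∫ b, φ a b ∂(ν : Measure β) ∂(μ : Measure α)

/-- Mixed strategy Nash equilibria of the simultaneous zero-sum game in which the first player
minimizes `φ` and the second one maximizes it. -/
def IsMixedNashEquilibrium [MeasurableSpace α] [MeasurableSpace β] (φ : α → β → ℝ)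
    (μ : ProbabilityMeasure α) (ν : ProbabilityMeasure β) : Prop :=
  (∀ μ', mixedPayoff φ μ ν ≤ mixedPayoff φ μ' ν) ∧ (∀ ν', mixedPayoff φ μ ν' ≤ mixedPayoff φ μ ν)

/-- `min_s max_t ψ(s, t) = v = max_t min_s ψ(s, t)`, with all maxima and minima attained. -/
def MinimaxHolds {S T : Type*} (ψ : S → T → ℝ) (v : ℝ) : Prop :=
  (∀ s, ∃ w, IsGreatest (range fun t => ψ s t) w) ∧
  (∀ t, ∃ w, IsLeast (range fun s => ψ s t) w) ∧
  IsLeast {w | ∃ s, IsGreatest (range fun t => ψ s t) w} v ∧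
  IsGreatest {w | ∃ t, IsLeast (range fun s => ψ s t) w} v

end Games

/-- `A` is an optimal universal (no-box) attack on `T` with attack radius `ε` against a class `H`
of classifiers: among all perturbed samples it maximizes the minimal empirical loss
`min_{f ∈ H} (1/N) ∑ᵢ L(f(x̄ᵢ), yᵢ)` over the class; all the minima are attained. -/
def IsOptimalUniversalAttack {N n m : ℕ} (H : Set ((Fin n → ℝ) → (Fin m → ℝ)))
    (L : (Fin m → ℝ) → Fin m → ℝ) (T : Fin N → (Fin n → ℝ) × Fin m) (ε : ℝ)
    (A : Fin N → (Fin n → ℝ) × Fin m) : Prop :=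
  A ∈ AdversarySpace T ε ∧
  ∃ v, IsLeast ((fun f => empiricalLoss L f A) '' H) v ∧
    ∀ A' ∈ AdversarySpace T ε, ∃ v', IsLeast ((fun f => empiricalLoss L f A') '' H) v' ∧ v' ≤ v

end AdvGame

end

namespace AdvGame

open Filter
/-! ### Zero-sum games with a continuous payoff on compact spaces -/

section ContinuousGames

variable {α β : Type*} [TopologicalSpace α] [TopologicalSpace β]

/-! Everything follows from joint continuity of the payoff (`continuous_payoff`) on compact,
nonempty strategy spaces. Adversary leading: the leader's value function is an extremum of
continuous functions, hence semicontinuous on a compact space, and attains its optimum; at an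
equilibrium this optimum is the best guaranteed loss, i.e. an optimal universal attack. Simultaneous
play: the probability measures form a weakly compact space on which the expected payoff is affine
and continuous in each variable, so Sion's theorem gives a saddle point. Any saddle point forces the
minimax equality. -/

theorem continuous_uncurry_swap {φ : α → β → ℝ} (hφ : Continuous (Function.uncurry φ)) :
    Continuous (Function.uncurry fun b a => φ a b) :=
  hφ.comp continuous_swap

theorem bestResponses_nonempty [CompactSpace β] [Nonempty β] {φ : α → β → ℝ} (hφ : Continuous (Function.uncurry φ))
    (a : α) : (bestResponses φ a).Nonempty := by
  obtain ⟨b, -, hb⟩ := isCompact_univ.exists_isMaxOn univ_nonempty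
    (hφ.uncurry_left a).continuousOn
  exact ⟨b, fun b' => hb (mem_univ b')⟩

/-- The value `φ a (r a)` is the supremum of `φ a b` over `b`, whatever best response `r a` is
chosen; `r` itself need not be continuous. -/
theorem exists_isStackelbergEquilibrium [CompactSpace α] [Nonempty α] [CompactSpace β]
    [Nonempty β] {φ : α → β → ℝ}
    (hφ : Continuous (Function.uncurry φ)) : ∃ a b, IsStackelbergEquilibrium φ a b := by
  have hne := bestResponses_nonempty hφ
  choose r hr using hne
  have hlsc : LowerSemicontinuousOn (fun a => φ a (r a)) univ :=
    lowerSemicontinuousOn_of_forall_isMaxOn_and_mem (f := fun b a => φ a b) (I := univ)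
      (fun b _ => (hφ.uncurry_right b).continuousOn.lowerSemicontinuousOn)
      (fun _ _ => mem_univ _) (fun a _ b _ => hr a b)
  obtain ⟨a, -, ha⟩ := hlsc.exists_isMinOn univ_nonempty isCompact_univ
  refine ⟨a, r a, fun a' => ⟨r a', hr a'⟩, hr a, fun p hp => ?_⟩
  exact (ha (mem_univ p.1)).trans (hp (r p.1))

/-! ### Mixed strategies and expected payoffs -/

theorem nonempty_probabilityMeasure (α : Type*) [MeasurableSpace α] [Nonempty α] :
    Nonempty (ProbabilityMeasure α) :=
  ⟨⟨Measure.dirac (Classical.arbitrary α), inferInstance⟩⟩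

variable [CompactSpace α] [CompactSpace β] [MeasurableSpace α] [MeasurableSpace β]

/-- A probability measure as a functional on continuous functions. -/
noncomputable def integralFunctional (μ : ProbabilityMeasure α) (g : C(α, ℝ)) : ℝ := ∫ a, g a ∂(μ : Measure α)

variable [BorelSpace α] [BorelSpace β]

theorem integrable_of_continuous_of_compactSpace {g : α → ℝ} (hg : Continuous g)
    (μ : ProbabilityMeasure α) : Integrable g (μ : Measure α) :=
  hg.integrable_of_hasCompactSupport (HasCompactSupport.of_compactSpace g)

/-- Weak convergence is tested on bounded continuous functions; on a compact space these are all the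
continuous ones. -/
theorem continuous_integralFunctional :
    Continuous (integralFunctional : ProbabilityMeasure α → C(α, ℝ) → ℝ) := by
  refine continuous_pi fun g => continuous_iff_continuousAt.2 fun μ => ?_
  exact ProbabilityMeasure.tendsto_iff_forall_integral_tendsto.1 tendsto_id
    (BoundedContinuousFunction.mkOfCompact g)

theorem convex_range_integralFunctional :
    Convex ℝ (range (integralFunctional : ProbabilityMeasure α → C(α, ℝ) → ℝ)) := by
  rintro _ ⟨μ, rfl⟩ _ ⟨ν, rfl⟩ s t hs ht hst
  have hprob : IsProbabilityMeasure
      (ENNReal.ofReal s • (μ : Measure α) + ENNReal.ofReal t • (ν : Measure α)) :=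
    ⟨by simp [← ENNReal.ofReal_add hs ht, hst]⟩
  refine ⟨⟨_, hprob⟩, funext fun g => ?_⟩
  have hμ := integrable_of_continuous_of_compactSpace g.continuous μ
  have hν := integrable_of_continuous_of_compactSpace g.continuous ν
  change ∫ a, g a ∂(ENNReal.ofReal s • (μ : Measure α) + ENNReal.ofReal t • (ν : Measure α)) = _
  rw [integral_add_measure (hμ.smul_measure ENNReal.ofReal_ne_top)
    (hν.smul_measure ENNReal.ofReal_ne_top), integral_smul_measure, integral_smul_measure,
    ENNReal.toReal_ofReal hs, ENNReal.toReal_ofReal ht]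
  rfl

variable [SecondCountableTopology α] [SecondCountableTopology β]

omit [MeasurableSpace α] [BorelSpace α] [SecondCountableTopology β] in
theorem continuous_integral_right {φ : α → β → ℝ} (hφ : Continuous (Function.uncurry φ))
    (ν : ProbabilityMeasure β) : Continuous fun a => ∫ b, φ a b ∂(ν : Measure β) := by
  obtain ⟨C, hC⟩ := (isCompact_range hφ).isBounded.exists_norm_le
  exact continuous_of_dominated (bound := fun _ => C)
    (fun a => (hφ.uncurry_left a).aestronglyMeasurable)
    (fun a => ae_of_all _ fun b => hC _ ⟨(a, b), rfl⟩) (integrable_const _)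
    (ae_of_all _ fun b => hφ.uncurry_right b)

omit [SecondCountableTopology α] in
theorem integrable_prod_of_continuous {φ : α → β → ℝ} (hφ : Continuous (Function.uncurry φ))
    (μ : ProbabilityMeasure α) (ν : ProbabilityMeasure β) :
    Integrable (Function.uncurry φ) ((μ : Measure α).prod (ν : Measure β)) :=
  hφ.integrable_of_hasCompactSupport (HasCompactSupport.of_compactSpace _)

theorem mixedPayoff_swap {φ : α → β → ℝ} (hφ : Continuous (Function.uncurry φ))
    (μ : ProbabilityMeasure α) (ν : ProbabilityMeasure β) :
    mixedPayoff φ μ ν = mixedPayoff (fun b a => φ a b) ν μ :=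
  integral_integral_swap (integrable_prod_of_continuous hφ μ ν)

/-- The payoff of a mixed strategy of the second player, as a function of the first player's pure
strategy. -/
noncomputable def averagedPayoff {φ : α → β → ℝ} (hφ : Continuous (Function.uncurry φ))
    (ν : ProbabilityMeasure β) : C(α, ℝ) :=
  ⟨fun a => ∫ b, φ a b ∂(ν : Measure β), continuous_integral_right hφ ν⟩

theorem mixedPayoff_eq_left {φ : α → β → ℝ} (hφ : Continuous (Function.uncurry φ))
    (μ : ProbabilityMeasure α) (ν : ProbabilityMeasure β) :
    mixedPayoff φ μ ν = integralFunctional μ (averagedPayoff hφ ν) := rfl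

theorem mixedPayoff_eq_right {φ : α → β → ℝ} (hφ : Continuous (Function.uncurry φ))
    (μ : ProbabilityMeasure α) (ν : ProbabilityMeasure β) :
    mixedPayoff φ μ ν =
      integralFunctional ν (averagedPayoff (continuous_uncurry_swap hφ) μ) :=
  mixedPayoff_swap hφ μ ν

theorem continuous_mixedPayoff_left {φ : α → β → ℝ} (hφ : Continuous (Function.uncurry φ))
    (ν : ProbabilityMeasure β) : Continuous fun μ => mixedPayoff φ μ ν :=
  (continuous_apply (averagedPayoff hφ ν)).comp continuous_integralFunctional

theorem continuous_mixedPayoff_right {φ : α → β → ℝ} (hφ : Continuous (Function.uncurry φ))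
    (μ : ProbabilityMeasure α) : Continuous fun ν => mixedPayoff φ μ ν := by
  simp only [mixedPayoff_swap hφ μ]
  exact continuous_mixedPayoff_left (continuous_uncurry_swap hφ) μ

variable [T2Space α] [T2Space β] [Nonempty α] [Nonempty β]

/-- Glicksberg's theorem: a zero-sum game with a continuous payoff on compact strategy spaces has
a mixed strategy Nash equilibrium. -/
theorem exists_isMixedNashEquilibrium {φ : α → β → ℝ} (hφ : Continuous (Function.uncurry φ)) :
    ∃ μ ν, IsMixedNashEquilibrium φ μ ν := by
  have := nonempty_probabilityMeasure α
  have := nonempty_probabilityMeasure β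
  -- Sion's theorem needs convex sets in a vector space, so measures are replaced by their
  -- functionals in a product space. `invFun` picks a representing measure; only the values of `f`
  -- on the two ranges matter.
  let I : ProbabilityMeasure α → C(α, ℝ) → ℝ := integralFunctional
  let J : ProbabilityMeasure β → C(β, ℝ) → ℝ := integralFunctional
  let f : (C(α, ℝ) → ℝ) → (C(β, ℝ) → ℝ) → ℝ := fun x y =>
    mixedPayoff φ (Function.invFun I x) (Function.invFun J y)
  have hI : ∀ x ∈ range I, I (Function.invFun I x) = x := fun x hx => Function.invFun_eq hx
  have hJ : ∀ y ∈ range J, J (Function.invFun J y) = y := fun y hy => Function.invFun_eq hy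
  -- On the ranges, `f` is evaluation at an averaged payoff in each variable: linear and continuous,
  -- whichever representing measure was picked.
  have hfx : ∀ y, EqOn (fun x => x (averagedPayoff hφ (Function.invFun J y)))
      (fun x => f x y) (range I) := fun y x hx => by
    change _ = mixedPayoff φ _ _
    rw [mixedPayoff_eq_left hφ]
    exact (congrFun (hI x hx) _).symm
  have hfy : ∀ x, EqOn (fun y => y (averagedPayoff (continuous_uncurry_swap hφ)
      (Function.invFun I x))) (fun y => f x y) (range J) := fun x y hy => by
    change _ = mixedPayoff φ _ _
    rw [mixedPayoff_eq_right hφ]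
    exact (congrFun (hJ y hy) _).symm
  have cI : Convex ℝ (range I) := convex_range_integralFunctional
  have cJ : Convex ℝ (range J) := convex_range_integralFunctional
  obtain ⟨x, hx, y, hy, h⟩ := Sion.exists_isSaddlePointOn (f := f)
    (range_nonempty I) cI
    (isCompact_range continuous_integralFunctional)
    (fun y _ => ((continuous_apply _).continuousOn.congr (hfx y).symm).lowerSemicontinuousOn)
    (fun y _ => (((LinearMap.proj (averagedPayoff hφ (Function.invFun J y)) :
      (C(α, ℝ) → ℝ) →ₗ[ℝ] ℝ).convexOn cI).congr (hfx y)).quasiconvexOn)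
    cJ (range_nonempty J) (isCompact_range continuous_integralFunctional)
    (fun x _ => ((continuous_apply _).continuousOn.congr (hfy x).symm).upperSemicontinuousOn)
    (fun x _ => (((LinearMap.proj (averagedPayoff (continuous_uncurry_swap hφ)
      (Function.invFun I x)) : (C(β, ℝ) → ℝ) →ₗ[ℝ] ℝ).concaveOn cJ).congr
        (hfy x)).quasiconcaveOn)
  refine ⟨Function.invFun I x, Function.invFun J y, fun μ => ?_, fun ν => ?_⟩
  · calc f x y ≤ f (I μ) y := h (I μ) (mem_range_self μ) y hy
      _ = _ := (hfx y (mem_range_self μ)).symm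
  · calc _ = f x (J ν) := by
          rw [mixedPayoff_eq_right hφ]
          exact hfy x (mem_range_self ν)
      _ ≤ f x y := h x hx (J ν) (mem_range_self ν)

/-- Extrema are attained by weak compactness. Any worst-case value of `s` is at least its payoff
against `ν`, hence at least the equilibrium value; dually for `t`. -/
theorem IsMixedNashEquilibrium.minimaxHolds {φ : α → β → ℝ}
    (hφ : Continuous (Function.uncurry φ)) {μ : ProbabilityMeasure α} {ν : ProbabilityMeasure β}
    (h : IsMixedNashEquilibrium φ μ ν) :
    MinimaxHolds (mixedPayoff φ) (mixedPayoff φ μ ν) := by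
  have := nonempty_probabilityMeasure α
  have := nonempty_probabilityMeasure β
  refine ⟨fun s => ?_, fun t => ?_, ⟨⟨μ, mem_range_self ν, ?_⟩, ?_⟩,
    ⟨⟨ν, mem_range_self μ, ?_⟩, ?_⟩⟩
  · exact (isCompact_range (continuous_mixedPayoff_right hφ s)).exists_isGreatest
      (range_nonempty _)
  · exact (isCompact_range (continuous_mixedPayoff_left hφ t)).exists_isLeast (range_nonempty _)
  · rintro _ ⟨ν', rfl⟩
    exact h.2 ν'
  · rintro w ⟨s, hs⟩
    exact (h.1 s).trans (hs.2 (mem_range_self ν))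
  · rintro _ ⟨μ', rfl⟩
    exact h.1 μ'
  · rintro w ⟨t, ht⟩
    exact (ht.2 (mem_range_self μ)).trans (h.2 t)

end ContinuousGames

/-! ### Networks -/

theorem continuous_entry {K : ℕ} (e : Fin K ⊕ ℝ) : Continuous fun Θ : Fin K → ℝ => entry Θ e := by
  cases e with
  | inl k => exact continuous_apply k
  | inr c => exact continuous_const

theorem Architecture.continuous_net {K n m : ℕ} (𝒩 : Architecture K n m) :
    Continuous fun p : (Fin K → ℝ) × (Fin n → ℝ) => 𝒩.net p.1 p.2 := by
  induction 𝒩 with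
  | input => exact continuous_snd
  | layer prev W b σ hσ ih =>
    refine continuous_pi fun j => ?_
    obtain ⟨c, hc⟩ := hσ j
    refine hc.continuous.comp (.add (continuous_finsetSum _ fun i _ => .mul ?_ ?_) ?_)
    · exact (continuous_entry (W j i)).comp continuous_fst
    · exact (continuous_apply i).comp ih
    · exact (continuous_entry (b j)).comp continuous_fst

theorem isCompact_classifierSpace (K : ℕ) (E : ℝ) : IsCompact (ClassifierSpace K E) := by
  have h : ClassifierSpace K E = univ.pi fun _ => Icc (-E) E := by
    ext Θ
    simp only [ClassifierSpace, mem_ofPred_eq, mem_univ_pi]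
  rw [h]
  exact isCompact_univ_pi fun _ => isCompact_Icc

theorem isCompact_adversarySpace {N n m : ℕ} (T : Fin N → (Fin n → ℝ) × Fin m) (ε : ℝ) :
    IsCompact (AdversarySpace T ε) := by
  have h : AdversarySpace T ε =
      univ.pi fun i => Metric.closedBall (T i).1 ε ×ˢ {(T i).2} := by
    ext A
    simp [AdversarySpace, dist_eq_norm]
  rw [h]
  exact isCompact_univ_pi fun i => (isCompact_closedBall _ _).prod isCompact_singleton

theorem continuous_payoff {K N n m : ℕ} (𝒩 : Architecture K n m) {L : (Fin m → ℝ) → Fin m → ℝ}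
    (hL : ∀ y, Continuous fun z => L z y) (T : Fin N → (Fin n → ℝ) × Fin m) (E ε : ℝ) :
    Continuous (Function.uncurry (payoff 𝒩 L T E ε)) := by
  -- Labels are discrete, so continuity for each fixed label gives joint continuity.
  have hL' : Continuous fun p : (Fin m → ℝ) × Fin m => L p.1 p.2 :=
    continuous_prod_of_discrete_right.2 hL
  refine continuous_const.mul (continuous_finsetSum _ fun i _ => ?_)
  have hA : Continuous fun p : ClassifierSpace K E × AdversarySpace T ε => p.2.1 i :=
    (continuous_apply i).comp (continuous_subtype_val.comp continuous_snd)
  exact hL'.comp ((𝒩.continuous_net.comp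
    ((continuous_subtype_val.comp continuous_fst).prodMk hA.fst)).prodMk hA.snd)

/-! ### Equilibria and universal attacks -/

theorem isLeast_payoff_of_mem_bestResponses {K N n m : ℕ} {𝒩 : Architecture K n m}
    {L : (Fin m → ℝ) → Fin m → ℝ} {T : Fin N → (Fin n → ℝ) × Fin m} {E ε : ℝ}
    {Θ : ClassifierSpace K E} {A : AdversarySpace T ε}
    (h : Θ ∈ bestResponses (fun A' Θ' => -payoff 𝒩 L T E ε Θ' A') A) :
    IsLeast ((fun f => empiricalLoss L f A.1) '' hypothesisClass 𝒩 E) (payoff 𝒩 L T E ε Θ A) := by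
  refine ⟨⟨_, ⟨Θ.1, Θ.2, rfl⟩, rfl⟩, ?_⟩
  rintro _ ⟨_, ⟨Θ', hΘ', rfl⟩, rfl⟩
  exact neg_le_neg_iff.1 (h ⟨Θ', hΘ'⟩)

theorem IsMaxminStackelbergEquilibrium.isOptimalUniversalAttack {K N n m : ℕ}
    {𝒩 : Architecture K n m} {L : (Fin m → ℝ) → Fin m → ℝ} {T : Fin N → (Fin n → ℝ) × Fin m}
    {E ε : ℝ} {Θ : ClassifierSpace K E} {A : AdversarySpace T ε}
    (h : IsMaxminStackelbergEquilibrium (payoff 𝒩 L T E ε) Θ A) :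
    IsOptimalUniversalAttack (hypothesisClass 𝒩 E) L T ε A.1 := by
  obtain ⟨hne, hmem, hopt⟩ := h
  refine ⟨A.2, _, isLeast_payoff_of_mem_bestResponses hmem, fun A' hA' => ?_⟩
  obtain ⟨Θ', hΘ'⟩ := hne ⟨A', hA'⟩
  exact ⟨_, isLeast_payoff_of_mem_bestResponses hΘ', neg_le_neg_iff.1 (hopt (⟨A', hA'⟩, Θ') hΘ')⟩

end AdvGame

/-- Finite-sample universal-adversary game (Adversary leads): a Stackelberg equilibrium exists, and
every one gives an optimal universal attack whose worst-case value is the equilibrium payoff.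
Simultaneous game: expected payoffs are well defined, a mixed strategy Nash equilibrium exists, and
the minimax theorem holds at every such equilibrium. -/
theorem mainTheorem5 {K N n m : ℕ} (hN : 0 < N)
    (𝒩 : AdvGame.Architecture K n m)
    (L : (Fin m → ℝ) → Fin m → ℝ) (hL : ∀ y, Continuous fun z => L z y)
    (T : Fin N → (Fin n → ℝ) × Fin m) (hT : ∀ i j, (T i).1 j ∈ Set.Icc (0 : ℝ) 1)
    (E ε : ℝ) (hE : 0 ≤ E) (hε : 0 ≤ ε) :
    ((∃ (Θ : AdvGame.ClassifierSpace K E) (A : AdvGame.AdversarySpace T ε),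
        AdvGame.IsMaxminStackelbergEquilibrium (AdvGame.payoff 𝒩 L T E ε) Θ A) ∧
      ∀ (Θ : AdvGame.ClassifierSpace K E) (A : AdvGame.AdversarySpace T ε),
        AdvGame.IsMaxminStackelbergEquilibrium (AdvGame.payoff 𝒩 L T E ε) Θ A →
          AdvGame.IsOptimalUniversalAttack (AdvGame.hypothesisClass 𝒩 E) L T ε A.1 ∧
          IsLeast ((fun f => AdvGame.empiricalLoss L f A.1) '' AdvGame.hypothesisClass 𝒩 E)
            (AdvGame.payoff 𝒩 L T E ε Θ A)) ∧
    ((∀ (μ : ProbabilityMeasure (AdvGame.ClassifierSpace K E))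
        (ν : ProbabilityMeasure (AdvGame.AdversarySpace T ε)),
        Integrable (fun p => AdvGame.payoff 𝒩 L T E ε p.1 p.2)
          ((μ : Measure (AdvGame.ClassifierSpace K E)).prod
            (ν : Measure (AdvGame.AdversarySpace T ε)))) ∧
      (∃ (μ : ProbabilityMeasure (AdvGame.ClassifierSpace K E))
        (ν : ProbabilityMeasure (AdvGame.AdversarySpace T ε)),
        AdvGame.IsMixedNashEquilibrium (AdvGame.payoff 𝒩 L T E ε) μ ν) ∧
      ∀ (μ : ProbabilityMeasure (AdvGame.ClassifierSpace K E))
        (ν : ProbabilityMeasure (AdvGame.AdversarySpace T ε)),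
        AdvGame.IsMixedNashEquilibrium (AdvGame.payoff 𝒩 L T E ε) μ ν →
          AdvGame.MinimaxHolds (AdvGame.mixedPayoff (AdvGame.payoff 𝒩 L T E ε))
            (AdvGame.mixedPayoff (AdvGame.payoff 𝒩 L T E ε) μ ν)) := by
  have hφ := AdvGame.continuous_payoff 𝒩 hL T E ε
  have : CompactSpace (AdvGame.ClassifierSpace K E) :=
    isCompact_iff_compactSpace.1 (AdvGame.isCompact_classifierSpace K E)
  have : CompactSpace (AdvGame.AdversarySpace T ε) :=
    isCompact_iff_compactSpace.1 (AdvGame.isCompact_adversarySpace T ε)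
  have : Nonempty (AdvGame.ClassifierSpace K E) := ⟨⟨0, fun _ => ⟨neg_nonpos.2 hE, hE⟩⟩⟩
  have : Nonempty (AdvGame.AdversarySpace T ε) := ⟨⟨T, fun i => ⟨by simpa using hε, rfl⟩⟩⟩
  refine ⟨⟨?_, fun Θ A h => ⟨h.isOptimalUniversalAttack,
    AdvGame.isLeast_payoff_of_mem_bestResponses h.2.1⟩⟩,
    AdvGame.integrable_prod_of_continuous hφ, AdvGame.exists_isMixedNashEquilibrium hφ,
    fun μ ν h => h.minimaxHolds hφ⟩
  -- Negating the payoff makes the Adversary a minimizing leader.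
  obtain ⟨A, Θ, h⟩ := AdvGame.exists_isStackelbergEquilibrium
    (φ := fun A Θ => -AdvGame.payoff 𝒩 L T E ε Θ A) (AdvGame.continuous_uncurry_swap hφ).neg
  exact ⟨Θ, A, h⟩
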